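/- Model. Let $V,W,M\ge 1$ and $B\ge 2$ be integers. Time is divided into cycles $0,1,2,\dots$. A finite input sequence specifies, for each cycle, a finite list of arriving unit-size packets; each packet $p$ has a work $w(p)\in\{1,\dots,W\}$ and a profit $v(p)\in\{1,\dots,V\}$, and is either known (a $K$-packet: work and profit are visible upon arrival) or unknown (a $U$-packet: they are revealed only when the packet is processed for the first time). At most $M$ $U$-packets arrive in any single cycle. Each cycle has three steps: (i) transmission, in which all fully processed packets leave the queue; (ii) arrival, in which new packets arrive and it is decided which of the queued and arriving packets are retained, at most $B$ in total (all others are lost); (iii) processing, in which at most one retained packet receives one cycle of processing. A packet is fully processed after $w(p)$ processing cycles. The throughput is the total profit of all packets that are ever transmitted. A deterministic online algorithm bases its decisions in a cycle only on the visible data of the arrivals so far and on the characteristics of the packets it has processed so far; a randomized algorithm is a probability distribution over deterministic online algorithms. A randomized algorithm is $\rho$-competitive ($\rho\ge1$) if for every input sequence the throughput of every feasible, possibly clairvoyant, schedule with the same buffer size $B$ is at most $\rho$ times the expected throughput of the algorithm; its competitive ratio is the infimum of all such $\rho$ ($\infty$ if there is none). Corollary. There is an absolute constant $c>0$ such that for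 all integers $V,W,M\ge1$ and $B\ge2$: (a) every randomized algorithm has competitive ratio at least $c\min\{VW,M\}$; (b) (uniform profits) if the inputs are restricted to sequences in which every packet has profit $1$, every randomized algorithm has competitive ratio at least $c\min\{W,M\}$; (c) (uniform work) if the inputs are restricted to sequences in which every packet has work exactly $W$, every randomized algorithm has competitive ratio at least $c\min\{V,M\}$. -/

import Mathlib

open MeasureTheory
open scoped ENNReal NNReal

namespace MistQueue

/-- A unit-size packet: its required number of processing cycles, its profit, and whether these
characteristics are visible upon arrival (`K`-packet, `known = true`) or not (`U`-packet). -/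
structure Packet where
  work : ℕ
  profit : ℕ
  known : Bool

/-- A finite input sequence: entry `t` is the list of packets arriving in cycle `t`.
After the end of the list, cycles go on without arrivals. -/
abbrev Input := List (List Packet)

/-- A packet is named by its arrival cycle and its position among the arrivals of that cycle;
the name carries no information about work or profit. -/
abbrev PacketId := ℕ × ℕ

namespace Input

/-- The packets arriving in cycle `t`. -/
def arrivals (σ : Input) (t : ℕ) : List Packet := σ.getD t []

/-- The names of the packets arriving in cycle `t`. -/
def arrivingIds (σ : Input) (t : ℕ) : Finset PacketId :=
  (Finset.range (σ.arrivals t).length).image fun i => (t, i)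

/-- The names of all packets of the input. -/
def ids (σ : Input) : Finset PacketId := (Finset.range σ.length).biUnion σ.arrivingIds

/-- The packet with a given name. -/
def packet? (σ : Input) (q : PacketId) : Option Packet := (σ.arrivals q.1)[q.2]?

/-- The work of a named packet. -/
def work (σ : Input) (q : PacketId) : ℕ := (σ.packet? q).elim 0 Packet.work

/-- The profit of a named packet. -/
def profit (σ : Input) (q : PacketId) : ℕ := (σ.packet? q).elim 0 Packet.profit

/-- What is visible of the arrivals of cycle `t`: `(work, profit)` for a `K`-packet and `none` for
a `U`-packet. -/
def view (σ : Input) (t : ℕ) : List (Option (ℕ × ℕ)) :=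
  (σ.arrivals t).map fun p => if p.known then some (p.work, p.profit) else none

end Input

/-- The inputs in which every packet has work in `{w, …, W}` and profit in `{1, …, V}`, and in
which at most `M` `U`-packets arrive in any single cycle. -/
def inputClass (w W V M : ℕ) : Set Input :=
  {σ | ∀ a ∈ σ, (∀ p ∈ a, w ≤ p.work ∧ p.work ≤ W ∧ 1 ≤ p.profit ∧ p.profit ≤ V) ∧
    (a.filter fun p => !p.known).length ≤ M}

/-- The decisions taken in one cycle: the set of packets retained in the queue at the end of the
arrival step, and the packet (if any) assigned to the processing element in the processing step. -/
structure Decision where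
  keep : Finset PacketId
  serve : Option PacketId

/-- A schedule: the decisions of all cycles. -/
abbrev Schedule := ℕ → Decision

namespace Schedule

/-- The number of processing cycles spent on packet `q` before cycle `t`. -/
def served (S : Schedule) (t : ℕ) (q : PacketId) : ℕ :=
  ((Finset.range t).filter fun s => (S s).serve = some q).card

/-- The content of the buffer after the transmission step of cycle `t`: it is empty at the start,
and later consists of the packets retained in the previous cycle that are not fully processed
(the fully processed ones have just been transmitted). -/
def buffer (S : Schedule) (σ : Input) : ℕ → Finset PacketId
  | 0 => ∅
  | t + 1 => (S t).keep.filter fun q => S.served (t + 1) q < σ.work q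

/-- A schedule is feasible for the input `σ` and a buffer of size `B` if in every cycle the retained
packets are among those that are in the buffer or have just arrived, there are at most `B` of
them, and only a retained packet is processed. -/
def Feasible (S : Schedule) (σ : Input) (B : ℕ) : Prop :=
  ∀ t, (S t).keep ⊆ S.buffer σ t ∪ σ.arrivingIds t ∧ (S t).keep.card ≤ B ∧
    ∀ q, (S t).serve = some q → q ∈ (S t).keep

/-- Packet `q` is transmitted: for some `t`, it is in the queue in cycle `t` and is fully
processed by the end of that cycle, so that it leaves in the transmission step of cycle `t + 1`. -/
def Transmits (S : Schedule) (σ : Input) (q : PacketId) : Prop :=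
  ∃ t, q ∈ (S t).keep ∧ σ.work q ≤ S.served (t + 1) q

open Classical in
/-- The throughput: the overall profit of all packets that are ever transmitted. -/
noncomputable def throughput (S : Schedule) (σ : Input) : ℕ :=
  ∑ q ∈ σ.ids.filter (fun q => S.Transmits σ q), σ.profit q

end Schedule

/-- What is learnt in one cycle: the visible part of the arrivals, and the `(work, profit)` of the
packet that was processed (so a `U`-packet is revealed when it is processed for the first time). -/
structure Observation where
  arrivals : List (Option (ℕ × ℕ))
  revealed : Option (ℕ × ℕ)

/-- A deterministic online algorithm: the decision of a cycle is a function of the observations of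
all earlier cycles and of the visible part of the current arrivals. (Its own earlier
decisions are determined by the earlier observations.) -/
abbrev OnlineAlg := List Observation → List (Option (ℕ × ℕ)) → Decision

namespace OnlineAlg

/-- The observations made by the algorithm on input `σ` in the cycles before cycle `t`. -/
def history (A : OnlineAlg) (σ : Input) : ℕ → List Observation
  | 0 => []
  | t + 1 => A.history σ t ++
      [⟨σ.view t, (A (A.history σ t) (σ.view t)).serve.bind fun q =>
        (σ.packet? q).map fun p => (p.work, p.profit)⟩]

/-- The schedule produced by the algorithm on input `σ`. -/
def schedule (A : OnlineAlg) (σ : Input) : Schedule :=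
  fun t => A (A.history σ t) (σ.view t)

end OnlineAlg

/-- A randomized online algorithm for the inputs in `C` and a buffer of size `B`: a random choice of
a deterministic online algorithm that produces feasible schedules on all inputs in `C`, such that
the throughput on each such input is a random variable. -/
structure RandomizedAlg.{u} (C : Set Input) (B : ℕ) where
  Seed : Type u
  [measurableSpace : MeasurableSpace Seed]
  law : Measure Seed
  [isProbabilityMeasure : IsProbabilityMeasure law]
  alg : Seed → OnlineAlg
  feasible : ∀ ω, ∀ σ ∈ C, ((alg ω).schedule σ).Feasible σ B
  measurable_throughput : ∀ σ ∈ C, Measurable fun ω => ((alg ω).schedule σ).throughput σ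

attribute [instance] RandomizedAlg.measurableSpace RandomizedAlg.isProbabilityMeasure

namespace RandomizedAlg

variable {C : Set Input} {B : ℕ}

/-- The expected throughput on input `σ`. -/
noncomputable def expectedThroughput (A : RandomizedAlg C B) (σ : Input) : ℝ≥0∞ :=
  ∫⁻ ω, (((A.alg ω).schedule σ).throughput σ : ℝ≥0∞) ∂A.law

/-- `A` is `ρ`-competitive (`ρ ≥ 1`): on every input in `C`, the throughput of any feasible
(possibly clairvoyant) schedule is at most `ρ` times the expected throughput of `A`. -/
def IsCompetitive (A : RandomizedAlg C B) (ρ : ℝ≥0) : Prop :=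
  1 ≤ ρ ∧ ∀ σ ∈ C, ∀ S : Schedule, S.Feasible σ B →
    (S.throughput σ : ℝ≥0∞) ≤ ρ * A.expectedThroughput σ

/-- The competitive ratio: the infimum of all `ρ` for which `A` is `ρ`-competitive (`∞` if there
is no such `ρ`). -/
noncomputable def competitiveRatio (A : RandomizedAlg C B) : ℝ≥0∞ :=
  ⨅ (ρ : ℝ≥0) (_ : A.IsCompetitive ρ), (ρ : ℝ≥0∞)

end RandomizedAlg

end MistQueue

open MistQueue

namespace MistQueue

/-! The proof is Yao's averaging argument. For `T = 2 * a * n` cycles, `M` unknown packets arrive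
per cycle; each is independently, with probability `1 / (a * M)`, a hit of work `a` and profit `V`,
and otherwise a miss of work `W` and profit `1`.

A deterministic online algorithm cannot tell a hit from a miss before serving it, and it serves at
most `T` packets before time `T`. So it finds at most `T / (a * M) = 2 * n / M` hits on average
(`mul_sum_foundHits_le`). Completed misses bring at most `T / W`, and packets still queued at time
`T` at most `V * B`. If `μ ≤ M`, `μ * a ≤ W * V` and `n = B * μ`, these contributions are at most
`2`, `2` and `1` times `n * V / μ` (`mul_sum_throughput_le`).

A clairvoyant schedule cuts time into `n` windows of length `2 * a`. The first half of a window
brings `a * M` packets, so it contains a hit with probability at least `1 / 2`, and that hit can be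
completed within the window. The average optimum is thus at least `n * V / 2`, and the ratio at
least `μ / 10`. The three claims differ only in the choice of `a`, `V` and `μ`. -/

/-! ### Service counts and throughput of a schedule -/

theorem Schedule.served_mono (S : Schedule) (q : PacketId) {s t : ℕ} (h : s ≤ t) :
    S.served s q ≤ S.served t q :=
  Finset.card_le_card (Finset.filter_subset_filter _ (Finset.range_mono h))

theorem Schedule.served_pos_iff (S : Schedule) (q : PacketId) (t : ℕ) :
    0 < S.served t q ↔ ∃ s < t, (S s).serve = some q := by
  simp [Schedule.served, Finset.card_pos, Finset.filter_nonempty_iff]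

/-- A cycle serves at most one packet, so the sets of cycles spent on different packets are
disjoint. -/
theorem Schedule.sum_served_le (S : Schedule) (t : ℕ) (I : Finset PacketId) :
    ∑ q ∈ I, S.served t q ≤ t := by
  classical
  unfold Schedule.served
  rw [← Finset.card_biUnion]
  · calc _ ≤ (Finset.range t).card := Finset.card_le_card (by
          intro s hs
          simp only [Finset.mem_biUnion, Finset.mem_filter] at hs
          obtain ⟨_, _, h, _⟩ := hs
          exact h)
      _ = t := Finset.card_range t
  · intro p _ q _ hpq
    rw [Function.onFun, Finset.disjoint_left]
    intro s hs hs'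
    simp only [Finset.mem_filter] at hs hs'
    exact hpq (Option.some.inj (hs.2.symm.trans hs'.2))

theorem Input.arrivingIds_eq_empty {σ : Input} {t : ℕ} (h : σ.length ≤ t) :
    σ.arrivingIds t = ∅ := by
  simp [Input.arrivingIds, Input.arrivals, List.getElem?_eq_none h]

/-- Once arrivals have ended, the queue can only shrink. -/
theorem Schedule.Feasible.mem_keep_of_le {S : Schedule} {σ : Input} {B T t : ℕ}
    (hS : S.Feasible σ B) (hT : σ.length ≤ T) (ht : T ≤ t) {q : PacketId}
    (hq : q ∈ (S t).keep) : q ∈ (S T).keep := by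
  induction t, ht using Nat.le_induction with
  | base => exact hq
  | succ t ht ih =>
    have h := (hS (t + 1)).1 hq
    rw [Input.arrivingIds_eq_empty (by omega), Finset.union_empty] at h
    exact ih (Finset.mem_filter.1 h).1

/-- A transmitted packet is completed before time `T`, or it is still queued at time `T`, provided
that nothing arrives from time `T` on. -/
theorem Schedule.Feasible.throughput_le {S : Schedule} {σ : Input} {B T : ℕ}
    (hS : S.Feasible σ B) (hT : σ.length ≤ T) :
    S.throughput σ ≤ ∑ q ∈ σ.ids.filter (fun q => σ.work q ≤ S.served T q), σ.profit q
      + ∑ q ∈ (S T).keep, σ.profit q := by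
  classical
  unfold Schedule.throughput
  refine le_trans (Finset.sum_le_sum_of_subset ?_)
    (Nat.le.intro (Finset.sum_union_inter (f := σ.profit)))
  intro q hq
  simp only [Finset.mem_filter, Finset.mem_union] at hq ⊢
  obtain ⟨hid, t, hk, hw⟩ := hq
  rcases le_or_gt T t with h | h
  · exact Or.inr (hS.mem_keep_of_le hT h hk)
  · exact Or.inl ⟨hid, hw.trans (S.served_mono q h)⟩

/-! ### Indistinguishability of inputs for online algorithms -/

/-- Until an algorithm serves `q`, it does not see the characteristics of the `U`-packet `q`. -/
theorem OnlineAlg.history_congr (A : OnlineAlg) {σ σ' : Input} {q : PacketId}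
    (hview : ∀ t, σ.view t = σ'.view t) (hp : ∀ r, r ≠ q → σ.packet? r = σ'.packet? r) (t : ℕ)
    (h : ∀ s < t, (A.schedule σ s).serve ≠ some q) : A.history σ' t = A.history σ t := by
  induction t with
  | zero => rfl
  | succ t ih =>
    have ht := h t (Nat.lt_succ_self t)
    simp only [OnlineAlg.history, ih fun s hs => h s (by omega), ← hview]
    simp only [OnlineAlg.schedule] at ht
    cases hs : (A (A.history σ t) (σ.view t)).serve with
    | none => rfl
    | some r =>
      have hr : r ≠ q := fun e => ht (by rw [hs, e])
      simp [hp r hr]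

theorem OnlineAlg.serves_of_serves (A : OnlineAlg) {σ σ' : Input} {q : PacketId}
    (hview : ∀ t, σ.view t = σ'.view t) (hp : ∀ r, r ≠ q → σ.packet? r = σ'.packet? r) {T : ℕ}
    (h : ∃ s < T, (A.schedule σ s).serve = some q) :
    ∃ s < T, (A.schedule σ' s).serve = some q := by
  classical
  -- At the first service of `q`, the two histories still coincide, so the same decision is taken on
  -- both inputs.
  have hm := fun s => Nat.find_min h (m := s)
  obtain ⟨hT, hs⟩ := Nat.find_spec h
  refine ⟨Nat.find h, hT, ?_⟩
  have := A.history_congr hview hp (Nat.find h) fun s hs h' => hm s hs ⟨by omega, h'⟩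
  simp only [OnlineAlg.schedule] at hs
  rwa [OnlineAlg.schedule, this, ← hview]

/-! ### Rectangular inputs -/

/-- The input with `M` packets in each of the first `T` cycles, given by `p`. -/
def gridInput (T M : ℕ) (p : PacketId → Packet) : Input :=
  (List.range T).map fun t => (List.range M).map fun j => p (t, j)

section gridInput

variable {T M : ℕ} {p : PacketId → Packet}

theorem length_gridInput : (gridInput T M p).length = T := by simp [gridInput]

theorem arrivals_gridInput {t : ℕ} (ht : t < T) :
    (gridInput T M p).arrivals t = (List.range M).map fun j => p (t, j) := by
  simp [gridInput, Input.arrivals, ht]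

theorem packet?_gridInput {q : PacketId} (h1 : q.1 < T) (h2 : q.2 < M) :
    (gridInput T M p).packet? q = some (p q) := by
  simp [Input.packet?, arrivals_gridInput h1, h2]

theorem packet?_gridInput_eq_none {q : PacketId} (h : ¬(q.1 < T ∧ q.2 < M)) :
    (gridInput T M p).packet? q = none := by
  by_cases h1 : q.1 < T
  · simpa [Input.packet?, arrivals_gridInput h1, h1] using h
  · simp [Input.packet?, Input.arrivals, gridInput, h1]

theorem mem_arrivingIds_gridInput {q : PacketId} (h1 : q.1 < T) (h2 : q.2 < M) :
    q ∈ (gridInput T M p).arrivingIds q.1 := by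
  simp only [Input.arrivingIds, arrivals_gridInput h1, List.length_map, List.length_range,
    Finset.mem_image, Finset.mem_range]
  exact ⟨q.2, h2, rfl⟩

theorem mem_ids_gridInput {q : PacketId} :
    q ∈ (gridInput T M p).ids ↔ q.1 < T ∧ q.2 < M := by
  simp only [Input.ids, Finset.mem_biUnion, Finset.mem_range, length_gridInput]
  constructor
  · rintro ⟨t, ht, hq⟩
    simp only [Input.arrivingIds, arrivals_gridInput ht, List.length_map, List.length_range,
      Finset.mem_image, Finset.mem_range] at hq
    obtain ⟨j, hj, rfl⟩ := hq
    exact ⟨ht, hj⟩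
  · rintro ⟨h1, h2⟩
    exact ⟨q.1, h1, mem_arrivingIds_gridInput h1 h2⟩

end gridInput

/-! ### The family of hard inputs -/

section hardInput

variable {T M N : ℕ} [NeZero N]

/-- The packet named `q` is one of the valuable packets selected by `g`. -/
def IsHit (g : Fin T × Fin M → Fin N) (q : PacketId) : Prop :=
  ∃ (h1 : q.1 < T) (h2 : q.2 < M), g (⟨q.1, h1⟩, ⟨q.2, h2⟩) = 0

open Classical in
/-- All packets are unknown; the hits have work `a` and profit `V`, the others work `W` and
profit `1`. -/
noncomputable def hardPacket (a V W : ℕ) (g : Fin T × Fin M → Fin N) (q : PacketId) : Packet :=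
  if IsHit g q then ⟨a, V, false⟩ else ⟨W, 1, false⟩

/-- The input of the packets `hardPacket`. -/
noncomputable def hardInput (a V W : ℕ) (g : Fin T × Fin M → Fin N) : Input :=
  gridInput T M (hardPacket a V W g)

variable {a V W : ℕ} {g : Fin T × Fin M → Fin N}

theorem hardInput_mem_inputClass {w : ℕ} (hwa : w ≤ a) (haW : a ≤ W) (hV : 1 ≤ V) :
    hardInput a V W g ∈ inputClass w W V M := by
  intro l hl
  simp only [hardInput, gridInput, List.mem_map, List.mem_range] at hl
  obtain ⟨t, _, rfl⟩ := hl
  constructor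
  · intro p hp
    simp only [List.mem_map, List.mem_range] at hp
    obtain ⟨j, _, rfl⟩ := hp
    unfold hardPacket
    split_ifs <;> simp <;> omega
  · exact (List.length_filter_le _ _).trans (by simp)

/-- The right-hand side does not involve `g`: arrivals carry no information about which packets are
hits. -/
theorem view_hardInput (t : ℕ) :
    (hardInput a V W g).view t = if t < T then List.replicate M none else [] := by
  unfold Input.view
  split_ifs with ht
  · rw [hardInput, arrivals_gridInput ht, List.map_map, List.eq_replicate_iff]
    refine ⟨by simp, ?_⟩
    intro b hb
    rw [List.mem_map] at hb
    obtain ⟨j, _, rfl⟩ := hb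
    by_cases h : IsHit g (t, j) <;> simp [hardPacket, h]
  · simp [hardInput, gridInput, Input.arrivals, ht]

theorem IsHit.work_eq {q : PacketId} (h : IsHit g q) : (hardInput a V W g).work q = a := by
  have h' := h
  obtain ⟨h1, h2, _⟩ := h'
  simp [Input.work, hardInput, packet?_gridInput h1 h2, hardPacket, h]

theorem IsHit.profit_eq {q : PacketId} (h : IsHit g q) : (hardInput a V W g).profit q = V := by
  have h' := h
  obtain ⟨h1, h2, _⟩ := h'
  simp [Input.profit, hardInput, packet?_gridInput h1 h2, hardPacket, h]

theorem work_of_not_isHit {q : PacketId} (h : ¬ IsHit g q) (h1 : q.1 < T) (h2 : q.2 < M) :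
    (hardInput a V W g).work q = W := by
  simp [Input.work, hardInput, packet?_gridInput h1 h2, hardPacket, h]

theorem profit_of_not_isHit {q : PacketId} (h : ¬ IsHit g q) :
    (hardInput a V W g).profit q ≤ 1 := by
  by_cases hq : q.1 < T ∧ q.2 < M
  · simp [Input.profit, hardInput, packet?_gridInput hq.1 hq.2, hardPacket, h]
  · simp [Input.profit, hardInput, packet?_gridInput_eq_none hq]

theorem profit_hardInput_le (hV : 1 ≤ V) (q : PacketId) : (hardInput a V W g).profit q ≤ V := by
  by_cases h : IsHit g q
  · exact h.profit_eq.le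
  · exact (profit_of_not_isHit h).trans hV

/-- The name of a packet of the grid. -/
def gridId (x : Fin T × Fin M) : PacketId := (x.1, x.2)

theorem isHit_gridId {x : Fin T × Fin M} : IsHit g (gridId x) ↔ g x = 0 := by
  simp [IsHit, gridId]

theorem gridId_injective : Function.Injective (gridId : Fin T × Fin M → PacketId) := by
  rintro ⟨x, y⟩ ⟨x', y'⟩ h
  simp only [gridId, Prod.mk.injEq] at h
  exact Prod.ext (Fin.ext h.1) (Fin.ext h.2)

theorem ids_hardInput : (hardInput a V W g).ids =
    (Finset.univ : Finset (Fin T × Fin M)).image gridId := by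
  ext q
  simp only [hardInput, mem_ids_gridInput, Finset.mem_image, Finset.mem_univ, true_and]
  constructor
  · rintro ⟨h1, h2⟩
    exact ⟨(⟨q.1, h1⟩, ⟨q.2, h2⟩), rfl⟩
  · rintro ⟨x, rfl⟩
    exact ⟨x.1.2, x.2.2⟩

/-- Whether a packet is served before time `t` does not depend on its own characteristics. -/
theorem served_pos_congr (A : OnlineAlg) {g g' : Fin T × Fin M → Fin N} {x : Fin T × Fin M}
    (h : ∀ y, y ≠ x → g y = g' y) (t : ℕ) :
    0 < (A.schedule (hardInput a V W g)).served t (gridId x) ↔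
      0 < (A.schedule (hardInput a V W g')).served t (gridId x) := by
  have hp : ∀ r, r ≠ gridId x →
      (hardInput a V W g).packet? r = (hardInput a V W g').packet? r := by
    intro r hr
    by_cases hq : r.1 < T ∧ r.2 < M
    · have : IsHit g r ↔ IsHit g' r := by
        have hne : (⟨⟨r.1, hq.1⟩, ⟨r.2, hq.2⟩⟩ : Fin T × Fin M) ≠ x := by
          rintro rfl
          exact hr rfl
        simp [IsHit, hq.1, hq.2, h _ hne]
      rw [hardInput, hardInput, packet?_gridInput hq.1 hq.2, packet?_gridInput hq.1 hq.2]
      by_cases hh : IsHit g r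
      · simp [hardPacket, hh, this.1 hh]
      · simp [hardPacket, hh, mt this.2 hh]
    · simp [hardInput, packet?_gridInput_eq_none hq]
  have hv : ∀ t, (hardInput a V W g).view t = (hardInput a V W g').view t := by
    simp [view_hardInput]
  rw [Schedule.served_pos_iff, Schedule.served_pos_iff]
  exact ⟨A.serves_of_serves hv hp,
    A.serves_of_serves (fun t => (hv t).symm) fun r hr => (hp r hr).symm⟩

end hardInput

/-! ### Counting random functions -/

/-- A uniformly random function vanishes at `x` with probability `1 / N`, independently of any event
that does not depend on the value at `x`. -/
theorem mul_card_filter_and_eq_zero {ι : Type*} [Fintype ι] [DecidableEq ι] {N : ℕ} [NeZero N]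
    (P : (ι → Fin N) → Prop) [DecidablePred P] (x : ι)
    (hP : ∀ g g', (∀ y, y ≠ x → g y = g' y) → (P g ↔ P g')) :
    N * (Finset.univ.filter fun g => P g ∧ g x = 0).card = (Finset.univ.filter P).card := by
  -- Overwriting the value at `x` is a bijection between the fibres of `P` over `0` and over `c`.
  have key : ∀ c : Fin N, (Finset.univ.filter fun g => P g ∧ g x = 0).card =
      (Finset.univ.filter fun g => P g ∧ g x = c).card := by
    intro c
    refine Finset.card_bij' (fun g _ => Function.update g x c) (fun g _ => Function.update g x 0)
      ?_ ?_ ?_ ?_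
    · intro g hg
      simp only [Finset.mem_filter, Finset.mem_univ, true_and, Function.update_self, and_true]
        at hg ⊢
      exact (hP g _ fun y hy => (Function.update_of_ne hy _ _).symm).1 hg.1
    · intro g hg
      simp only [Finset.mem_filter, Finset.mem_univ, true_and, Function.update_self, and_true]
        at hg ⊢
      exact (hP g _ fun y hy => (Function.update_of_ne hy _ _).symm).1 hg.1
    · intro g hg
      simp only [Finset.mem_filter, Finset.mem_univ, true_and] at hg
      simp [← hg.2]
    · intro g hg
      simp only [Finset.mem_filter, Finset.mem_univ, true_and] at hg
      simp [← hg.2]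
  rw [Finset.card_eq_sum_card_fiberwise (s := Finset.univ.filter P) (f := fun g => g x)
    (t := Finset.univ) (fun _ _ => Finset.mem_coe.2 (Finset.mem_univ _))]
  simp_rw [Finset.filter_filter]
  rw [Finset.sum_congr rfl fun c _ => (key c).symm]
  simp

theorem two_mul_pred_pow_le (N : ℕ) (hN : 1 ≤ N) : 2 * (N - 1) ^ N ≤ N ^ N := by
  obtain ⟨m, rfl⟩ := Nat.exists_eq_add_of_le' hN
  simp only [Nat.add_sub_cancel]
  rcases Nat.eq_zero_or_pos m with rfl | hm
  · simp
  -- Bernoulli's inequality `1 + k / m ≤ (1 + 1 / m) ^ k` without denominators, to be used at `k = m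
  -- + 1`.
  have key : ∀ k, m ^ k * (m + k) ≤ m * (m + 1) ^ k := by
    intro k
    induction k with
    | zero => simp
    | succ k ih =>
      calc m ^ (k + 1) * (m + (k + 1)) = m ^ k * (m * (m + k + 1)) := by ring
        _ ≤ m ^ k * ((m + k) * (m + 1)) := Nat.mul_le_mul_left _ (by nlinarith)
        _ = m ^ k * (m + k) * (m + 1) := by ring
        _ ≤ m * (m + 1) ^ k * (m + 1) := Nat.mul_le_mul_right _ ih
        _ = m * (m + 1) ^ (k + 1) := by ring
  refine Nat.le_of_mul_le_mul_left ?_ hm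
  calc m * (2 * m ^ (m + 1)) = m ^ (m + 1) * (m + m) := by ring
    _ ≤ m ^ (m + 1) * (m + (m + 1)) := Nat.mul_le_mul_left _ (by omega)
    _ ≤ _ := key (m + 1)

/-- A uniformly random function to `Fin N` has a zero on a given set of `N` points with probability
at least `1 / 2`. -/
theorem card_le_two_mul_card_exists_eq_zero {ι : Type*} [Fintype ι] [DecidableEq ι] {N : ℕ}
    [NeZero N] (s : Finset ι) (hs : s.card = N) :
    Fintype.card (ι → Fin N) ≤
      2 * (Finset.univ.filter fun g : ι → Fin N => ∃ x ∈ s, g x = 0).card := by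
  -- The functions without a zero on `s` form a product set, a fraction `((N - 1) / N) ^ N ≤ 1 / 2`
  -- of all functions.
  have h1 : (Finset.univ.filter fun g : ι → Fin N => ¬ ∃ x ∈ s, g x = 0) =
      Fintype.piFinset fun x => if x ∈ s then {0}ᶜ else Finset.univ := by
    ext g
    simp only [Finset.mem_filter, Finset.mem_univ, true_and, Fintype.mem_piFinset, not_exists,
      not_and]
    refine forall_congr' fun x => ?_
    split_ifs with h <;> simp [h]
  have h2 : 2 * (Finset.univ.filter fun g : ι → Fin N => ¬ ∃ x ∈ s, g x = 0).card ≤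
      Fintype.card (ι → Fin N) := by
    have hc : ∀ x, (if x ∈ s then ({0}ᶜ : Finset (Fin N)) else Finset.univ).card =
        if x ∈ s then N - 1 else N := by
      intro x
      split_ifs <;> simp [Finset.card_compl]
    have hle : s.card ≤ Fintype.card ι := Finset.card_le_univ s
    have hu : Fintype.card ι = N + (Fintype.card ι - N) := by omega
    rw [h1, Fintype.card_piFinset, Finset.prod_congr rfl fun x _ => hc x, Finset.prod_ite,
      Finset.prod_const, Finset.prod_const, Finset.filter_mem_eq_inter, Finset.univ_inter, hs,
      Finset.filter_not, Finset.filter_mem_eq_inter, Finset.univ_inter,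
      Finset.card_sdiff_of_subset (Finset.subset_univ s), Finset.card_univ, hs, ← mul_assoc]
    simp only [Fintype.card_fun, Fintype.card_fin]
    conv_rhs => rw [hu, pow_add]
    exact Nat.mul_le_mul_right _ (two_mul_pred_pow_le N (Nat.one_le_iff_ne_zero.2 (NeZero.ne N)))
  have h3 := Finset.card_filter_add_card_filter_not (s := (Finset.univ : Finset (ι → Fin N)))
    (fun g => ∃ x ∈ s, g x = 0)
  rw [Finset.card_univ] at h3
  omega

/-! ### Upper bound for online algorithms -/

section upperBound

variable {T M N : ℕ} [NeZero N] {a V W B : ℕ}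

open Classical in
/-- The number of hits that the algorithm finds before time `T`. -/
noncomputable def foundHits (A : OnlineAlg) (a V W : ℕ) (g : Fin T × Fin M → Fin N) : ℕ :=
  (Finset.univ.filter fun x : Fin T × Fin M =>
    0 < (A.schedule (hardInput a V W g)).served T (gridId x) ∧ g x = 0).card

/-- Whether `x` is served is independent of `g x`, so a served packet is a hit for one in `N`
functions; and at most `T` packets are served before time `T`. Double counting over pairs of a
function and a packet combines the two facts. -/
theorem mul_sum_foundHits_le (A : OnlineAlg) :
    N * ∑ g : Fin T × Fin M → Fin N, foundHits A a V W g ≤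
      Fintype.card (Fin T × Fin M → Fin N) * T := by
  classical
  calc N * ∑ g : Fin T × Fin M → Fin N, foundHits A a V W g
      = ∑ x : Fin T × Fin M, N * (Finset.univ.filter fun g : Fin T × Fin M → Fin N =>
          0 < (A.schedule (hardInput a V W g)).served T (gridId x) ∧ g x = 0).card := by
        simp only [foundHits, Finset.card_filter, ← Finset.mul_sum]
        rw [Finset.sum_comm]
    _ = ∑ x : Fin T × Fin M, (Finset.univ.filter fun g : Fin T × Fin M → Fin N =>
          0 < (A.schedule (hardInput a V W g)).served T (gridId x)).card :=
        Finset.sum_congr rfl fun x _ =>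
          mul_card_filter_and_eq_zero
            (fun g => 0 < (A.schedule (hardInput a V W g)).served T (gridId x)) x
            fun g g' h => served_pos_congr A h T
    _ = ∑ g : Fin T × Fin M → Fin N, (Finset.univ.filter fun x =>
          0 < (A.schedule (hardInput a V W g)).served T (gridId x)).card := by
        simp only [Finset.card_filter]
        rw [Finset.sum_comm]
    _ ≤ ∑ _g : Fin T × Fin M → Fin N, T := by
        refine Finset.sum_le_sum fun g _ => ?_
        refine le_trans ?_ ((A.schedule (hardInput a V W g)).sum_served_le T
          (Finset.univ.image (gridId : Fin T × Fin M → PacketId)))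
        rw [Finset.sum_image gridId_injective.injOn, Finset.card_filter]
        refine Finset.sum_le_sum fun x _ => ?_
        split_ifs <;> omega
    _ = _ := by simp

/-- The throughput on a hard input is at most that of the hits that are found, of the other packets,
each of which occupies `W` cycles, and of a full buffer. -/
theorem mul_throughput_hardInput_le (A : OnlineAlg) (g : Fin T × Fin M → Fin N) (ha : 1 ≤ a)
    (hV : 1 ≤ V) (hA : (A.schedule (hardInput a V W g)).Feasible (hardInput a V W g) B) :
    W * (A.schedule (hardInput a V W g)).throughput (hardInput a V W g) ≤
      W * (V * foundHits A a V W g) + T + W * (V * B) := by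
  classical
  set σ := hardInput a V W g with hσ
  set S := A.schedule σ with hS
  have h0 := hA.throughput_le (T := T) (by rw [hσ, hardInput, length_gridInput])
  have h1 : ∑ q ∈ (S T).keep, σ.profit q ≤ V * B := by
    calc _ ≤ ∑ q ∈ (S T).keep, V := Finset.sum_le_sum fun q _ => profit_hardInput_le hV q
      _ = V * (S T).keep.card := by rw [Finset.sum_const, smul_eq_mul, mul_comm]
      _ ≤ _ := Nat.mul_le_mul_left _ (hA T).2.1
  have h2 : W * ∑ q ∈ σ.ids.filter (fun q => σ.work q ≤ S.served T q), σ.profit q ≤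
      W * (V * foundHits A a V W g) + T := by
    -- Packet by packet: a completed hit has been served at least once, as `1 ≤ a`, so it counts as
    -- found; a completed miss pays for its profit with its own `W` cycles.
    have hp : ∀ x : Fin T × Fin M, W * (if σ.work (gridId x) ≤ S.served T (gridId x)
        then σ.profit (gridId x) else 0) ≤
        W * (V * if 0 < S.served T (gridId x) ∧ g x = 0 then 1 else 0) +
          S.served T (gridId x) := by
      intro x
      by_cases hx : g x = 0
      · have hh := isHit_gridId.2 hx
        rw [hσ, hh.work_eq, hh.profit_eq]
        by_cases hs : a ≤ S.served T (gridId x)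
        · simp [hs, hx, (show 0 < S.served T (gridId x) by omega)]
        · simp [hs]
      · have hh := fun h => hx (isHit_gridId.1 h)
        have hpr := profit_of_not_isHit (a := a) (V := V) (W := W) hh
        rw [hσ, work_of_not_isHit hh x.1.2 x.2.2]
        by_cases hs : W ≤ S.served T (gridId x)
        · rw [if_pos hs]
          exact ((Nat.mul_le_mul_left W hpr).trans (by rwa [mul_one])).trans (Nat.le_add_left _ _)
        · simp [hs]
    rw [hσ, ids_hardInput, ← hσ, Finset.sum_filter, Finset.sum_image gridId_injective.injOn,
      Finset.mul_sum]
    refine (Finset.sum_le_sum fun x _ => hp x).trans ?_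
    rw [Finset.sum_add_distrib, ← Finset.mul_sum, ← Finset.mul_sum, foundHits,
      Finset.card_filter]
    refine Nat.add_le_add_left ?_ _
    have := S.sum_served_le T (Finset.univ.image (gridId : Fin T × Fin M → PacketId))
    rwa [Finset.sum_image gridId_injective.injOn] at this
  nlinarith [Nat.mul_le_mul_left W h0, Nat.mul_le_mul_left W h1]

end upperBound

/-- The total throughput of an online algorithm over all hard inputs. -/
theorem mul_sum_throughput_le {M a V W B μ n : ℕ} [NeZero (a * M)] (A : OnlineAlg) (ha : 1 ≤ a)
    (hV : 1 ≤ V) (hW : 1 ≤ W) (hμM : μ ≤ M) (hμ : μ * a ≤ W * V) (hn : n = B * μ)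
    (hA : ∀ g : Fin (2 * a * n) × Fin M → Fin (a * M),
      (A.schedule (hardInput a V W g)).Feasible (hardInput a V W g) B) :
    μ * ∑ g : Fin (2 * a * n) × Fin M → Fin (a * M),
        (A.schedule (hardInput a V W g)).throughput (hardInput a V W g) ≤
      5 * (n * V * Fintype.card (Fin (2 * a * n) × Fin M → Fin (a * M))) := by
  set C := Fintype.card (Fin (2 * a * n) × Fin M → Fin (a * M)) with hC
  set X := ∑ g : Fin (2 * a * n) × Fin M → Fin (a * M), foundHits A a V W g with hX
  have h1 : μ * X ≤ C * (2 * n) := by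
    have := mul_sum_foundHits_le (T := 2 * a * n) (M := M) (N := a * M) (a := a) (V := V)
      (W := W) A
    rw [← hX, ← hC] at this
    have h : M * X ≤ C * (2 * n) := by
      refine Nat.le_of_mul_le_mul_left ?_ ha
      calc a * (M * X) = a * M * X := by ring
        _ ≤ _ := this
        _ = _ := by ring
    exact (Nat.mul_le_mul_right X hμM).trans h
  have h2 := Finset.sum_le_sum fun g (_ : g ∈ Finset.univ) =>
    mul_throughput_hardInput_le A g ha hV (hA g)
  rw [← Finset.mul_sum, Finset.sum_add_distrib, Finset.sum_add_distrib, ← Finset.mul_sum,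
    ← Finset.mul_sum, Finset.sum_const, Finset.sum_const, Finset.card_univ, smul_eq_mul,
    smul_eq_mul, ← hC, ← hX] at h2
  set Y := ∑ g : Fin (2 * a * n) × Fin M → Fin (a * M),
    (A.schedule (hardInput a V W g)).throughput (hardInput a V W g)
  refine Nat.le_of_mul_le_mul_left ?_ hW
  calc W * (μ * Y) = μ * (W * Y) := by ring
    _ ≤ μ * (W * (V * X) + C * (2 * a * n) + C * (W * (V * B))) := Nat.mul_le_mul_left _ h2
    _ = W * V * (μ * X) + μ * a * (2 * n * C) + C * (W * (V * (B * μ))) := by ring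
    -- Hits are bounded by `h1` and misses by `hμ`. With `B * μ = n`, hits, misses and the final
    -- buffer contribute `2 + 2 + 1 = 5`.
    _ ≤ W * V * (C * (2 * n)) + W * V * (2 * n * C) + C * (W * (V * (B * μ))) := by gcongr
    _ = W * (5 * (n * V * C)) := by rw [← hn]; ring

/-! ### The clairvoyant window schedule -/

section offline

/-- In the window of the cycles `2 * a * k, …, 2 * a * k + 2 * a - 1`, process the packet `pick k`
(if any) for `a` cycles from its arrival on. -/
def windowSchedule (a : ℕ) (pick : ℕ → Option PacketId) : Schedule := fun t =>
  match pick (t / (2 * a)) with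
  | none => ⟨∅, none⟩
  | some q => if q.1 ≤ t ∧ t < q.1 + a then ⟨{q}, some q⟩ else ⟨∅, none⟩

variable {a : ℕ} {pick : ℕ → Option PacketId}

theorem windowSchedule_cases (t : ℕ) :
    windowSchedule a pick t = ⟨∅, none⟩ ∨ ∃ q, pick (t / (2 * a)) = some q ∧ q.1 ≤ t ∧
      t < q.1 + a ∧ windowSchedule a pick t = ⟨{q}, some q⟩ := by
  unfold windowSchedule
  cases h : pick (t / (2 * a)) with
  | none => exact Or.inl rfl
  | some q =>
    by_cases hq : q.1 ≤ t ∧ t < q.1 + a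
    · exact Or.inr ⟨q, rfl, hq.1, hq.2, by simp [hq]⟩
    · exact Or.inl (by simp only [hq, if_false])

/-- A packet arriving in the first half of a window needs only `a` cycles, so its service does not
run into the next window. -/
theorem windowSchedule_eq {k t : ℕ} {q : PacketId} (hk : pick k = some q)
    (hq : 2 * a * k ≤ q.1 ∧ q.1 < 2 * a * k + a) (h1 : q.1 ≤ t) (h2 : t < q.1 + a) :
    windowSchedule a pick t = ⟨{q}, some q⟩ := by
  have : t / (2 * a) = k := Nat.div_eq_of_lt_le (by rw [mul_comm]; omega)
    (by rw [Nat.succ_mul, mul_comm]; omega)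
  simp [windowSchedule, this, hk, h1, h2]

theorem windowSchedule_feasible {σ : Input} {B : ℕ} (hB : 1 ≤ B)
    (hpick : ∀ k q, pick k = some q → (2 * a * k ≤ q.1 ∧ q.1 < 2 * a * k + a) ∧
      q ∈ σ.arrivingIds q.1 ∧ σ.work q = a) :
    (windowSchedule a pick).Feasible σ B := by
  intro t
  rcases windowSchedule_cases (a := a) (pick := pick) t with h | ⟨q, hk, h1, h2, h⟩
  · simp [h]
  · obtain ⟨hw, harr, hwork⟩ := hpick _ _ hk
    refine ⟨?_, by simpa [h] using hB, by simp [h]⟩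
    rw [h, Finset.singleton_subset_iff, Finset.mem_union]
    rcases h1.eq_or_lt with rfl | hlt
    · exact Or.inr harr
    · left
      obtain ⟨s, rfl⟩ : ∃ s, t = s + 1 := ⟨t - 1, by omega⟩
      simp only [Schedule.buffer, Finset.mem_filter, hwork]
      refine ⟨by simp [windowSchedule_eq hk hw (show q.1 ≤ s by omega) (by omega)], ?_⟩
      -- No service of `q` precedes its arrival, so fewer than `a` cycles have been spent on it and
      -- it is still in the buffer.
      have hsub : ((Finset.range (s + 1)).filter fun u =>
          (windowSchedule a pick u).serve = some q) ⊆ Finset.Ico q.1 (s + 1) := by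
        intro u hu
        simp only [Finset.mem_filter, Finset.mem_range, Finset.mem_Ico] at hu ⊢
        refine ⟨?_, hu.1⟩
        rcases windowSchedule_cases (a := a) (pick := pick) u with h' | ⟨r, _, hr, _, h'⟩
        · simp [h'] at hu
        · rw [h'] at hu
          rw [← Option.some.inj hu.2]
          exact hr
      have := Finset.card_le_card hsub
      rw [Nat.card_Ico] at this
      unfold Schedule.served
      omega

theorem windowSchedule_transmits {σ : Input} {k : ℕ} {q : PacketId} (ha : 1 ≤ a)
    (hk : pick k = some q) (hq : 2 * a * k ≤ q.1 ∧ q.1 < 2 * a * k + a) (hw : σ.work q = a) :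
    (windowSchedule a pick).Transmits σ q := by
  -- The last of the `a` service cycles; `Transmits` counts service up to and including it.
  refine ⟨q.1 + a - 1,
    by simp [windowSchedule_eq hk hq (show q.1 ≤ q.1 + a - 1 by omega) (by omega)], ?_⟩
  have hsub : Finset.Ico q.1 (q.1 + a) ⊆ ((Finset.range (q.1 + a - 1 + 1)).filter fun u =>
      (windowSchedule a pick u).serve = some q) := by
    intro u hu
    simp only [Finset.mem_filter, Finset.mem_range, Finset.mem_Ico] at hu ⊢
    exact ⟨by omega, by rw [windowSchedule_eq hk hq hu.1 hu.2]⟩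
  have := Finset.card_le_card hsub
  rw [Nat.card_Ico] at this
  unfold Schedule.served
  omega

end offline

/-! ### Lower bound for the optimum -/

section lowerBound

variable {M N a V W B n : ℕ} [NeZero N]

/-- The packets that arrive in the first half of window `k`. -/
def window (M a n : ℕ) (k : Fin n) : Finset (Fin (2 * a * n) × Fin M) :=
  Finset.univ.filter fun x => 2 * a * k ≤ x.1.1 ∧ x.1.1 < 2 * a * k + a

theorem card_window (k : Fin n) : (window M a n k).card = a * M := by
  have hlt : ∀ i : Fin a, 2 * a * k + i < 2 * a * n := fun i => by
    have h1 : 2 * a * (k + 1) ≤ 2 * a * n := Nat.mul_le_mul_left _ k.2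
    have := i.2
    rw [Nat.mul_succ] at h1
    omega
  have : window M a n k = (Finset.univ : Finset (Fin a × Fin M)).image
      fun y => (⟨2 * a * k + y.1, hlt y.1⟩, y.2) := by
    ext x
    simp only [window, Finset.mem_filter, Finset.mem_univ, true_and, Finset.mem_image]
    constructor
    · rintro ⟨h1, h2⟩
      refine ⟨(⟨x.1.1 - 2 * a * k, by omega⟩, x.2), Prod.ext (Fin.ext ?_) rfl⟩
      simp only
      omega
    · rintro ⟨y, rfl⟩
      have := y.1.2
      simp only
      omega
  rw [this, Finset.card_image_of_injective]
  · simp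
  · rintro ⟨i, j⟩ ⟨i', j'⟩ h
    simp only [Prod.mk.injEq, Fin.mk.injEq, Nat.add_left_cancel_iff] at h
    exact Prod.ext (Fin.ext h.1) h.2

open Classical in
/-- The number of windows with a hit in their first half. -/
noncomputable def hitWindows (a n : ℕ) (g : Fin (2 * a * n) × Fin M → Fin N) : ℕ :=
  (Finset.univ.filter fun k : Fin n => ∃ x ∈ window M a n k, g x = 0).card

/-- The hit probability `1 / N` is tuned to the `a * M` packets in half a window, so each window has
a hit for at least half of the functions. -/
theorem card_mul_le_two_mul_sum_hitWindows (hN : N = a * M) :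
    n * Fintype.card (Fin (2 * a * n) × Fin M → Fin N) ≤
      2 * ∑ g : Fin (2 * a * n) × Fin M → Fin N, hitWindows a n g := by
  classical
  calc n * Fintype.card (Fin (2 * a * n) × Fin M → Fin N)
      = ∑ _k : Fin n, Fintype.card (Fin (2 * a * n) × Fin M → Fin N) := by simp
    _ ≤ ∑ k : Fin n, 2 * (Finset.univ.filter fun g : Fin (2 * a * n) × Fin M → Fin N =>
          ∃ x ∈ window M a n k, g x = 0).card :=
        Finset.sum_le_sum fun k _ =>
          card_le_two_mul_card_exists_eq_zero _ ((card_window k).trans hN.symm)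
    _ = _ := by
        simp only [hitWindows, Finset.card_filter, ← Finset.mul_sum]
        rw [Finset.sum_comm]

theorem exists_feasible_throughput_ge (hB : 1 ≤ B) (ha : 1 ≤ a)
    (g : Fin (2 * a * n) × Fin M → Fin N) :
    ∃ S : Schedule, S.Feasible (hardInput a V W g) B ∧
      hitWindows a n g * V ≤ S.throughput (hardInput a V W g) := by
  classical
  set K := Finset.univ.filter fun k : Fin n => ∃ x ∈ window M a n k, g x = 0 with hK
  have hc : ∀ k : Fin n, ∃ o : Option PacketId, (k ∈ K → o.isSome) ∧ ∀ q, o = some q →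
      (2 * a * k ≤ q.1 ∧ q.1 < 2 * a * k + a) ∧ IsHit g q := by
    intro k
    by_cases hk : k ∈ K
    · obtain ⟨x, hx, hg⟩ := (Finset.mem_filter.1 hk).2
      refine ⟨some (gridId x), fun _ => rfl, ?_⟩
      rintro q hq
      obtain rfl := Option.some.inj hq
      exact ⟨(Finset.mem_filter.1 hx).2, isHit_gridId.2 hg⟩
    · exact ⟨none, fun h => absurd h hk, by simp⟩
  choose o ho1 ho2 using hc
  set pick : ℕ → Option PacketId := fun k => if h : k < n then o ⟨k, h⟩ else none with hpick
  have hp : ∀ k q, pick k = some q → (2 * a * k ≤ q.1 ∧ q.1 < 2 * a * k + a) ∧ IsHit g q := by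
    intro k q hq
    simp only [hpick] at hq
    split_ifs at hq with h
    exact ho2 ⟨k, h⟩ q hq
  refine ⟨windowSchedule a pick, windowSchedule_feasible hB fun k q hq => ?_, ?_⟩
  · obtain ⟨hw, hh⟩ := hp k q hq
    refine ⟨hw, ?_, hh.work_eq⟩
    obtain ⟨h1, h2, _⟩ := hh
    exact mem_arrivingIds_gridInput h1 h2
  · have hget : ∀ k : Fin n, k ∈ K → ∃ q, pick k = some q := by
      intro k hk
      obtain ⟨q, hq⟩ := Option.isSome_iff_exists.1 (ho1 k hk)
      exact ⟨q, by simp [hpick, hq]⟩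
    choose! f hf using hget
    -- The windows are disjoint, so hits picked in different windows are different packets.
    have hinj : Set.InjOn f K := by
      intro k hk k' hk' he
      have h1 := (hp _ _ (hf k hk)).1
      have h2 := (hp _ _ (hf k' hk')).1
      rw [he] at h1
      by_contra hne
      have hne' : (k : ℕ) ≠ k' := fun e => hne (Fin.ext e)
      rcases Nat.lt_or_gt_of_ne hne' with h | h
      · have := Nat.mul_le_mul_left (2 * a) (Nat.succ_le_of_lt h)
        rw [Nat.mul_succ] at this
        omega
      · have := Nat.mul_le_mul_left (2 * a) (Nat.succ_le_of_lt h)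
        rw [Nat.mul_succ] at this
        omega
    have hsum : hitWindows a n g * V =
        ∑ q ∈ K.image f, (hardInput a V W g).profit q := by
      rw [Finset.sum_image hinj,
        Finset.sum_congr rfl fun k hk => (hp _ _ (hf k hk)).2.profit_eq, Finset.sum_const,
        smul_eq_mul, hitWindows]
    rw [hsum, Schedule.throughput]
    refine Finset.sum_le_sum_of_subset fun q hq => ?_
    obtain ⟨k, hk, rfl⟩ := Finset.mem_image.1 hq
    obtain ⟨hw, hh⟩ := hp _ _ (hf k hk)
    refine Finset.mem_filter.2 ⟨?_, windowSchedule_transmits ha (hf k hk) hw hh.work_eq⟩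
    obtain ⟨h1, h2, _⟩ := hh
    exact mem_ids_gridInput.2 ⟨h1, h2⟩

end lowerBound

/-! ### Averaging and the competitive ratio -/

/-- Averaging over a finite family of inputs: if every deterministic algorithm has total throughput
at most `K` on the family, a `ρ`-competitive randomized algorithm forces the total optimal
throughput to be at most `ρ * K`. -/
theorem RandomizedAlg.IsCompetitive.sum_le {C : Set Input} {B : ℕ} {A : RandomizedAlg C B}
    {ρ : ℝ≥0} (h : A.IsCompetitive ρ) {ι : Type*} [Fintype ι] (σ : ι → Input)
    (hσ : ∀ i, σ i ∈ C) (opt : ι → ℕ)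
    (hopt : ∀ i, ∃ S : Schedule, S.Feasible (σ i) B ∧ opt i ≤ S.throughput (σ i)) (K : ℝ≥0∞)
    (hK : ∀ ω, ((∑ i, ((A.alg ω).schedule (σ i)).throughput (σ i) : ℕ) : ℝ≥0∞) ≤ K) :
    ((∑ i, opt i : ℕ) : ℝ≥0∞) ≤ ρ * K := by
  have h1 : ∑ i, A.expectedThroughput (σ i) ≤ K := by
    unfold RandomizedAlg.expectedThroughput
    rw [← lintegral_finsetSum]
    · calc _ ≤ ∫⁻ _, K ∂A.law := lintegral_mono fun ω => by
            have := hK ω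
            push_cast at this
            exact this
        _ = K := by simp
    · intro i _
      exact measurable_from_top.comp (A.measurable_throughput (σ i) (hσ i))
  calc ((∑ i, opt i : ℕ) : ℝ≥0∞) = ∑ i, (opt i : ℝ≥0∞) := by push_cast; rfl
    _ ≤ ∑ i, ρ * A.expectedThroughput (σ i) := by
        refine Finset.sum_le_sum fun i _ => ?_
        obtain ⟨S, hS, hle⟩ := hopt i
        exact (Nat.cast_le.2 hle).trans (h.2 (σ i) (hσ i) S hS)
    _ = ρ * ∑ i, A.expectedThroughput (σ i) := by rw [Finset.mul_sum]
    _ ≤ _ := by gcongr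

/-- Lower bound for the inputs whose hits have work `a` and profit `V`. -/
theorem RandomizedAlg.le_competitiveRatio {w W V M B a μ : ℕ} (hw : 1 ≤ w) (hwa : w ≤ a)
    (haW : a ≤ W) (hV : 1 ≤ V) (hM : 1 ≤ M) (hB : 1 ≤ B) (hμ0 : 1 ≤ μ) (hμM : μ ≤ M)
    (hμ : μ * a ≤ W * V) (A : RandomizedAlg (inputClass w W V M) B) :
    ((1 / 10 : ℝ≥0) : ℝ≥0∞) * (μ : ℝ≥0∞) ≤ A.competitiveRatio := by
  refine le_iInf₂ fun ρ hρ => ?_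
  have ha : 1 ≤ a := hw.trans hwa
  have : NeZero (a * M) := ⟨(Nat.mul_pos ha hM).ne'⟩
  -- Enough windows for the profit `V * B` of a full final buffer to be only `n * V / μ`.
  obtain ⟨n, hn⟩ : ∃ n, n = B * μ := ⟨_, rfl⟩
  have hn0 : 0 < n := hn ▸ Nat.mul_pos hB hμ0
  have hmem : ∀ g : Fin (2 * a * n) × Fin M → Fin (a * M),
      hardInput a V W g ∈ inputClass w W V M :=
    fun g => hardInput_mem_inputClass hwa haW hV
  set C := Fintype.card (Fin (2 * a * n) × Fin M → Fin (a * M)) with hC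
  have hC0 : 0 < C := Fintype.card_pos
  have hμ0' : (0 : ℝ≥0) < μ := by exact_mod_cast hμ0
  have key := hρ.sum_le (hardInput a V W) hmem (fun g => hitWindows a n g * V)
    (fun g => exists_feasible_throughput_ge hB ha g)
    (((5 * (n * V * C : ℕ) : ℝ≥0) / μ : ℝ≥0) : ℝ≥0∞) (by
      intro ω
      have := mul_sum_throughput_le (A.alg ω) ha hV (ha.trans haW) hμM hμ hn
        fun g => A.feasible ω _ (hmem g)
      rw [← ENNReal.coe_natCast, ENNReal.coe_le_coe, le_div_iff₀ hμ0', mul_comm]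
      exact_mod_cast this)
  rw [← ENNReal.coe_natCast, ← ENNReal.coe_mul, ENNReal.coe_le_coe, ← mul_div_assoc,
    le_div_iff₀ hμ0', ← Finset.sum_mul] at key
  have hlow := card_mul_le_two_mul_sum_hitWindows (M := M) (N := a * M) (a := a) (n := n) rfl
  rw [← hC] at hlow
  set H := ∑ g : Fin (2 * a * n) × Fin M → Fin (a * M), hitWindows a n g
  have hlow' : (n : ℝ≥0) * C ≤ 2 * H := by exact_mod_cast hlow
  rw [← ENNReal.coe_natCast, ← ENNReal.coe_mul, ENNReal.coe_le_coe]
  have hpos : (0 : ℝ≥0) < n * V * C := by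
    have : 0 < n * V * C := by positivity
    exact_mod_cast this
  -- The constant is `10 = 2 * 5`: a factor `2` from the hit probability of a window, `5` from the
  -- online bound.
  have hfin : (μ : ℝ≥0) * (n * V * C) ≤ 10 * ρ * (n * V * C) := by
    push_cast at key
    calc (μ : ℝ≥0) * (n * V * C) = n * C * (V * μ) := by ring
      _ ≤ 2 * H * (V * μ) := by gcongr
      _ = 2 * (H * V * μ) := by ring
      _ ≤ 2 * (ρ * (5 * (n * V * C))) := by gcongr
      _ = _ := by ring
  have := le_of_mul_le_mul_right hfin hpos
  rw [one_div, inv_mul_le_iff₀ (by norm_num)]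
  exact this

end MistQueue

open MistQueue
theorem corollary1 :
    ∃ c : ℝ≥0, 0 < c ∧ ∀ V W M B : ℕ, 1 ≤ V → 1 ≤ W → 1 ≤ M → 2 ≤ B →
      -- general works in {1, …, W} and profits in {1, …, V}
      (∀ A : RandomizedAlg (inputClass 1 W V M) B,
        (c : ℝ≥0∞) * ((min (V * W) M : ℕ) : ℝ≥0∞) ≤ A.competitiveRatio) ∧
      -- uniform profits: all profits are 1
      (∀ A : RandomizedAlg (inputClass 1 W 1 M) B,
        (c : ℝ≥0∞) * ((min W M : ℕ) : ℝ≥0∞) ≤ A.competitiveRatio) ∧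
      -- uniform work: all works are W
      (∀ A : RandomizedAlg (inputClass W W V M) B,
        (c : ℝ≥0∞) * ((min V M : ℕ) : ℝ≥0∞) ≤ A.competitiveRatio) := by
  refine ⟨1 / 10, by norm_num, fun V W M B hV hW hM hB => ⟨fun A => ?_, fun A => ?_, fun A => ?_⟩⟩
  -- Hits of work `1` and profit `V` against misses of work `W` and profit `1`.
  · exact A.le_competitiveRatio (a := 1) le_rfl le_rfl hW hV hM (by omega)
      (le_min (Nat.mul_pos hV hW) hM) (min_le_right _ _)
      (by rw [mul_one, mul_comm W V]; exact min_le_left _ _)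
  · exact A.le_competitiveRatio (a := 1) le_rfl le_rfl hW le_rfl hM (by omega)
      (le_min hW hM) (min_le_right _ _) (by simp)
  -- Hits and misses both have work `W` and differ only in profit; `μ * a ≤ W * V` becomes `μ * W ≤
  -- W * V`.
  · exact A.le_competitiveRatio (a := W) hW le_rfl le_rfl hV hM (by omega)
      (le_min hV hM) (min_le_right _ _)
      (by rw [mul_comm]; exact Nat.mul_le_mul_left _ (min_le_left _ _))
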